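/- All vector spaces and representations are over $\mathbb{C}$. For a group $G$, let $\mathrm{Conj}(G)$ be the quandle with underlying set $G$ and operation $x\triangleright y=xyx^{-1}$. For a quandle $Q$: a quandle representation of $Q$ on a vector space $V$ is a quandle morphism $\rho:Q\to\mathrm{Conj}(GL(V))$; it is irreducible if $V\neq 0$ and the only subspaces $W\subseteq V$ with $\rho(x)(W)\subseteq W$ for all $x\in Q$ are $0$ and $V$. A character of $Q$ is a quandle morphism $\chi:Q\to\mathrm{Conj}(\mathbb{C}^\times)$, and $(\chi\cdot\rho)(x)=\chi(x)\rho(x)$. $\mathrm{Inn}(Q)$ is the group of bijections of $Q$ generated by the left translations $L_x:y\mapsto x\triangleright y$; $G(Q)=\langle x\in Q\mid xyx^{-1}=x\triangleright y\rangle$ is the enveloping group, $\theta_{G(Q)}:G(Q)\to\mathrm{Inn}(Q)$ the morphism extending $x\mapsto L_x$, and $\rho_{G(Q)}:G(Q)\to GL(V)$ the morphism extending $\rho$. A projective representation $\sigma:\mathrm{Inn}(Q)\to PGL(V)$ is induced by $\rho$ if $\sigma(\theta_{G(Q)}(g))$ is the class of $\rho_{G(Q)}(g)$ in $PGL(V)$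 for all $g\in G(Q)$. A projective representation on $V\neq 0$ is irreducible if no proper nonempty projective subspace of $P(V)$ is stable under it. A group $G$ is a Schur cover of a group $H$ if there is a surjective morphism $\theta:G\to H$ whose kernel is contained in the center and in the derived subgroup of $G$ and is isomorphic to the Schur multiplier $H^2(H,\mathbb{C}^\times)$ (trivial action). **Theorem.** Let $G$ be a finite group which is a Schur cover of some group $H$. 1. For every complex vector space $V$, a quandle representation $\rho$ of $\mathrm{Conj}(G)$ on $V$ is irreducible if and only if $\rho=\chi\cdot\rho'$ for some character $\chi$ of $\mathrm{Conj}(G)$ and some irreducible linear representation $\rho'$ of the group $G$ on $V$. 2. Every irreducible projective representation $\sigma:\mathrm{Inn}(\mathrm{Conj}(G))\to PGL(V)$ is induced by an irreducible quandle representation of $\mathrm{Conj}(G)$ on $V$. In particular this holds for those $\sigma$ that do not lift to a linear representation of $\mathrm{Inn}(\mathrm{Conj}(G))=\mathrm{Inn}(G)$. -/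

import Mathlib

open scoped Quandles

universe u v w

noncomputable section

/-! ### Groups: Schur multiplier, stem extensions, Schur covers -/

/-- The Schur multiplier `H²(H, ℂˣ)`: second group cohomology of `H` with coefficients in the
trivial module `ℂˣ` (written additively). The base ring is `ℤ`, and ring and coefficients are
lifted to the universe of `H`, which leaves the underlying abelian group unchanged. -/
abbrev SchurMultiplier (H : Type v) [Group H] : Type v :=
  groupCohomology.H2 (Rep.trivial (ULift.{v} ℤ) H (ULift.{v} (Additive ℂˣ)))

/-- `θ : G → H` presents `G` as a stem extension of `H`: it is surjective, with kernel contained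
in the centre and in the derived subgroup of `G`. -/
structure IsStemExtension {G : Type u} {H : Type v} [Group G] [Group H] (θ : G →* H) : Prop where
  surjective : Function.Surjective θ
  ker_le_center : θ.ker ≤ Subgroup.center G
  ker_le_commutator : θ.ker ≤ commutator G

/-- `G` is a Schur cover of `H`: it is a stem extension of `H` whose kernel is isomorphic to the
Schur multiplier of `H`. -/
def IsSchurCover (G : Type u) (H : Type v) [Group G] [Group H] : Prop :=
  ∃ θ : G →* H, IsStemExtension θ ∧ Nonempty (Additive θ.ker ≃+ SchurMultiplier H)

/-! ### General and projective linear groups, projective representations -/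

section Projective

variable (V : Type w) [AddCommGroup V] [Module ℂ V]

/-- The inclusion of the nonzero scalars in `GL(V)`. -/
def scalarGL : ℂˣ →* LinearMap.GeneralLinearGroup ℂ V :=
  Units.map (algebraMap ℂ (Module.End ℂ V)).toMonoidHom

theorem scalarGL_mul_comm (c : ℂˣ) (g : LinearMap.GeneralLinearGroup ℂ V) :
    scalarGL V c * g = g * scalarGL V c :=
  Units.ext (Algebra.commutes (c : ℂ) (g : Module.End ℂ V))

instance scalarGL_range_normal : (scalarGL V).range.Normal where
  conj_mem := by
    rintro _ ⟨c, rfl⟩ g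
    rw [← scalarGL_mul_comm, mul_inv_cancel_right]
    exact ⟨c, rfl⟩

/-- The projective linear group `PGL(V) = GL(V) / ℂˣ`. -/
abbrev PGL : Type w := LinearMap.GeneralLinearGroup ℂ V ⧸ (scalarGL V).range

/-- The projection `GL(V) → PGL(V)`. -/
abbrev toPGL : LinearMap.GeneralLinearGroup ℂ V →* PGL V := QuotientGroup.mk' (scalarGL V).range

variable {V}

/-- A projective representation `A → PGL(V)` is irreducible if `V ≠ 0` and no proper nonempty
projective subspace of `P(V)` is stable: a linear subspace of `V` stable under all the linear maps
representing elements of the image is `0` or `V`. -/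
def IsIrreducibleProjective {A : Type u} [Group A] (σ : A →* PGL V) : Prop :=
  Nontrivial V ∧ ∀ W : Submodule ℂ V,
    (∀ (a : A) (g : LinearMap.GeneralLinearGroup ℂ V), toPGL V g = σ a →
      ∀ w ∈ W, (g : Module.End ℂ V) w ∈ W) → W = ⊥ ∨ W = ⊤

end Projective

/-! ### Quandles: inner automorphisms, characters and representations -/

/-- The group of inner automorphisms of a quandle: the group of bijections generated by the left
translations `L_x : y ↦ x ◃ y`. -/
abbrev Inn (Q : Type u) [Quandle Q] : Subgroup (Equiv.Perm Q) :=
  Subgroup.closure (Set.range fun x : Q => Rack.act' x)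

/-- The quandle morphism `Q → Inn(Q)`, `x ↦ L_x`. -/
def leftTranslation (Q : Type u) [Quandle Q] : Q →◃ Quandle.Conj (Inn Q) where
  toFun x := ⟨Rack.act' x, Subgroup.subset_closure ⟨x, rfl⟩⟩
  map_act' {x y} := Subtype.ext (Rack.ad_conj x y)

/-- The group morphism `G(Q) → Inn(Q)` extending `x ↦ L_x`, with `G(Q)` the enveloping group. -/
abbrev envelToInn (Q : Type u) [Quandle Q] : Rack.EnvelGroup Q →* Inn Q :=
  Rack.toEnvelGroup.map (leftTranslation Q)

/-- A character of a quandle: a quandle morphism to `ℂˣ`. -/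
abbrev QuandleCharacter (Q : Type u) [Quandle Q] : Type u := Q →◃ Quandle.Conj ℂˣ

/-- A (complex, linear) representation of a quandle on `V`: a quandle morphism to `GL(V)` with its
conjugacy quandle structure. -/
abbrev QuandleRep (Q : Type u) [Quandle Q] (V : Type w) [AddCommGroup V] [Module ℂ V] :
    Type (max u w) :=
  Q →◃ Quandle.Conj (LinearMap.GeneralLinearGroup ℂ V)

namespace QuandleRep

variable {Q : Type u} [Quandle Q] {V : Type w} [AddCommGroup V] [Module ℂ V]

/-- A quandle representation on `V` is irreducible if `V ≠ 0` and the only subspaces `W` with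
`ρ(x)(W) ⊆ W` for all `x` are `0` and `V`. -/
def IsIrreducible (ρ : QuandleRep Q V) : Prop :=
  Nontrivial V ∧ ∀ W : Submodule ℂ V,
    (∀ x : Q, ∀ w ∈ W, ((ρ x : LinearMap.GeneralLinearGroup ℂ V) : Module.End ℂ V) w ∈ W) → W = ⊥ ∨ W = ⊤

/-- The quandle representation `χ · ρ`, `x ↦ χ(x) ρ(x)`. -/
def twist (χ : QuandleCharacter Q) (ρ : QuandleRep Q V) : QuandleRep Q V where
  toFun x := (scalarGL V (χ x) * ρ x : LinearMap.GeneralLinearGroup ℂ V)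
  map_act' {x y} := by
    have hχ : ShelfHom.toFun χ (x ◃ y) = ShelfHom.toFun χ y := by
      rw [ShelfHom.map_act', Quandle.conj_act_eq_conj]
      exact mul_inv_cancel_comm _ _
    have hρ : ShelfHom.toFun ρ (x ◃ y) = (ShelfHom.toFun ρ x * ShelfHom.toFun ρ y *
        (ShelfHom.toFun ρ x)⁻¹ : LinearMap.GeneralLinearGroup ℂ V) := ShelfHom.map_act' ρ
    have h (c d : ℂˣ) (a b : LinearMap.GeneralLinearGroup ℂ V) :
        scalarGL V d * (a * b * a⁻¹) =
          scalarGL V c * a * (scalarGL V d * b) * (scalarGL V c * a)⁻¹ :=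
      calc scalarGL V d * (a * b * a⁻¹)
          = scalarGL V c * (scalarGL V d * (a * b * a⁻¹)) * (scalarGL V c)⁻¹ := by
            rw [scalarGL_mul_comm V c, mul_inv_cancel_right]
        _ = scalarGL V c * (scalarGL V d * a * b * a⁻¹) * (scalarGL V c)⁻¹ := by
            simp only [mul_assoc]
        _ = scalarGL V c * a * (scalarGL V d * b) * (scalarGL V c * a)⁻¹ := by
            rw [scalarGL_mul_comm V d a]
            simp only [mul_assoc, mul_inv_rev]
    change scalarGL V (ShelfHom.toFun χ (x ◃ y)) * ShelfHom.toFun ρ (x ◃ y) = _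
    rw [hχ, hρ, Quandle.conj_act_eq_conj]
    exact h _ _ _ _

/-- A linear representation of a group `G`, seen as a quandle representation of `Conj(G)`. -/
def ofRepresentation {G : Type u} [Group G] (ρ : Representation ℂ G V) :
    QuandleRep (Quandle.Conj G) V :=
  Quandle.Conj.map ρ.asGroupHom

/-- The projective representation `σ` of `Inn(Q)` is the one induced by the quandle representation
`ρ`: for every `g` in the enveloping group `G(Q)`, the value of `σ` at the image of `g` in `Inn(Q)`
is the class in `PGL(V)` of `ρ_{G(Q)}(g)`, where `ρ_{G(Q)} : G(Q) → GL(V)` extends `ρ`. As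
`G(Q) → Inn(Q)` is onto, at most one `σ` has this property. -/
def Induces (ρ : QuandleRep Q V) (σ : Inn Q →* PGL V) : Prop :=
  ∀ g : Rack.EnvelGroup Q, σ (envelToInn Q g) = toPGL V (Rack.toEnvelGroup.map ρ g)

end QuandleRep

end

/-! If `ρ` is an irreducible quandle representation of `Conj(G)`, then `ρ(gh)` and `ρ(g)ρ(h)`
conjugate every `ρ(x)` in the same way, so by Schur's lemma they differ by a scalar. Thus `ρ`
descends to a homomorphism `G → PGL(V)`, again by Schur trivial on the centre
(`IsIrreducible.exists_projective`). As `V` is not assumed finite-dimensional, Schur's lemma is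
proved from countable dimension.

Such a homomorphism lifts to `GL(V)` (`exists_lift_of_schurCover`): the obstruction is a class in
`H²(H, ℂˣ)`, and for a Schur cover each such class is the transgression of a character of the
kernel, which dies on `G`. Indeed transgression is injective for a stem extension, and both sides
are finite of equal size. The lift and `ρ` agree in `PGL(V)`, so they differ by a quandle character
(`exists_eq_twist`). For the second claim, pull `σ` back to `G` and lift it. -/

/-! ### Cocycles and the Schur multiplier -/

section Cohomology

variable {H : Type v} [Group H]

/-- Two-cocycle condition for a function `H → H → A` with trivial action. -/
def IsTrivialCocycle {A : Type*} [CommGroup A] (α : H → H → A) : Prop :=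
  ∀ a b c, α (a * b) c * α a b = α b c * α a (b * c)

/-- Only the fibres of the class map are recorded: additivity and surjectivity are replaced later by
a counting argument. -/
theorem exists_schurClass : ∃ cl : {α : H → H → ℂˣ // IsTrivialCocycle α} → SchurMultiplier H,
    ∀ α α', cl α = cl α' ↔
      ∃ f : H → ℂˣ, ∀ a b, α.1 a b * f (a * b) = α'.1 a b * (f a * f b) := by
  let A := Rep.trivial (ULift.{v} ℤ) H (ULift.{v} (Additive ℂˣ))
  have hmem (α : {α : H → H → ℂˣ // IsTrivialCocycle α}) :
      (fun p : H × H => (ULift.up (Additive.ofMul (α.1 p.1 p.2)) : A)) ∈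
        groupCohomology.cocycles₂ A := by
    rw [groupCohomology.mem_cocycles₂_iff]
    intro a b c
    exact congrArg (fun z => ULift.up (Additive.ofMul z)) (α.2 a b c)
  refine ⟨fun α => groupCohomology.H2π A ⟨_, hmem α⟩, fun α α' => ?_⟩
  rw [groupCohomology.H2π_eq_iff]
  constructor
  · rintro ⟨f, hf⟩
    refine ⟨fun a => Additive.toMul (ULift.down (f a)), fun a b => ?_⟩
    have h : Additive.toMul (ULift.down (f b)) / Additive.toMul (ULift.down (f (a * b))) *
        Additive.toMul (ULift.down (f a)) = α.1 a b / α'.1 a b :=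
      congrArg (fun z => Additive.toMul (ULift.down z)) (congrFun hf (a, b))
    rw [div_mul_eq_mul_div, div_eq_div_iff_mul_eq_mul] at h
    rw [← h, mul_comm, mul_comm (Additive.toMul (ULift.down (f a)))]
  · rintro ⟨f, hf⟩
    refine ⟨fun a => ULift.up (Additive.ofMul (f a)), funext fun p => ?_⟩
    have h : f p.2 / f (p.1 * p.2) * f p.1 = α.1 p.1 p.2 / α'.1 p.1 p.2 := by
      rw [div_mul_eq_mul_div, div_eq_div_iff_mul_eq_mul, hf, mul_comm, mul_comm (f p.2)]
    exact congrArg (fun z => ULift.up (Additive.ofMul z)) h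

end Cohomology


/-! ### Central extensions, transgression and lifting -/

section Extension

variable {G : Type u} {H : Type v} [Group G] [Group H] (θ : G →* H) (t : H → G)
  (ht : ∀ a, θ (t a) = a)

/-- The factor set of an extension relative to a section. -/
def factorSet (a b : H) : θ.ker :=
  ⟨t a * t b * (t (a * b))⁻¹, by simp [MonoidHom.mem_ker, ht]⟩

/-- The kernel component of an element relative to a section. -/
def kerPart (g : G) : θ.ker :=
  ⟨g * (t (θ g))⁻¹, by simp [MonoidHom.mem_ker, ht]⟩

variable {θ t}

theorem kerPart_mul (hK : θ.ker ≤ Subgroup.center G) (g g' : G) :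
    kerPart θ t ht (g * g') =
      kerPart θ t ht g * kerPart θ t ht g' * factorSet θ t ht (θ g) (θ g') := by
  apply Subtype.ext
  have h := Subgroup.mem_center_iff.1 (hK (kerPart θ t ht g').2) (t (θ g))
  simp only [kerPart, factorSet, Subgroup.coe_mul, map_mul] at h ⊢
  calc g * g' * (t (θ g * θ g'))⁻¹
      = g * (t (θ g))⁻¹ * (t (θ g) * (g' * (t (θ g'))⁻¹)) * t (θ g') * (t (θ g * θ g'))⁻¹ := by
        group
    _ = _ := by rw [h]; group

/-- Over a central extension, a map `s` on the quotient that is multiplicative up to the image of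
the factor set under a central character extends to a homomorphism. -/
theorem exists_hom_of_factorSet (hK : θ.ker ≤ Subgroup.center G) {Γ : Type*} [Group Γ]
    (ψ : θ.ker →* Γ) (hψ : ∀ k x, ψ k * x = x * ψ k) (s : H → Γ)
    (hs : ∀ a b, s a * s b = ψ (factorSet θ t ht a b) * s (a * b)) :
    ∃ T : G →* Γ, ∀ g, T g = ψ (kerPart θ t ht g) * s (θ g) := by
  refine ⟨MonoidHom.mk' (fun g => ψ (kerPart θ t ht g) * s (θ g)) fun g g' => ?_, fun g => rfl⟩
  rw [kerPart_mul ht hK, map_mul, map_mul, map_mul, mul_assoc _ _ (s _), ← hs]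
  simp only [mul_assoc]
  rw [← mul_assoc (s (θ g)), ← hψ, mul_assoc]

/-- A map that is multiplicative up to central scalars has a two-cocycle as defect. -/
theorem isTrivialCocycle_of_mul_eq {A Γ : Type*} [CommGroup A] [Group Γ] (c : A →* Γ)
    (hc : Function.Injective c) (hcomm : ∀ k x, c k * x = x * c k) {α : H → H → A} {s : H → Γ}
    (hs : ∀ a b, s a * s b = c (α a b) * s (a * b)) : IsTrivialCocycle α := by
  intro a b d
  apply hc
  apply mul_right_cancel (b := s (a * b * d))
  have h1 : s a * s b * s d = c (α a b) * c (α (a * b) d) * s (a * b * d) := by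
    rw [hs, mul_assoc, hs, ← mul_assoc]
  have h2 : s a * (s b * s d) = c (α b d) * c (α a (b * d)) * s (a * b * d) := by
    rw [hs b, ← mul_assoc, ← hcomm, mul_assoc, hs, mul_assoc, mul_assoc a b d]
  rw [mul_comm (α (a * b) d), map_mul, map_mul, ← h1, ← h2, mul_assoc]

theorem factorSet_cocycle (hK : θ.ker ≤ Subgroup.center G) (χ : θ.ker →* ℂˣ) :
    IsTrivialCocycle fun a b => χ (factorSet θ t ht a b) := by
  let _ : CommGroup θ.ker := { (inferInstance : Group θ.ker) with
    mul_comm := fun a b => Subtype.ext (Subgroup.mem_center_iff.1 (hK b.2) a) }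
  have h : IsTrivialCocycle (factorSet θ t ht) :=
    isTrivialCocycle_of_mul_eq θ.ker.subtype θ.ker.subtype_injective
      (fun k x => (Subgroup.mem_center_iff.1 (hK k.2) x).symm) (s := t) fun a b => by
        simp [factorSet]
  intro a b d
  simpa only [map_mul] using congrArg χ (h a b d)

/-- For a stem extension, a character of the kernel whose transgression is a coboundary is
trivial. -/
theorem eq_one_of_factorSet_coboundary (hθ : IsStemExtension θ) (χ : θ.ker →* ℂˣ) (f : H → ℂˣ)
    (hf : ∀ a b, f a * f b = χ (factorSet θ t ht a b) * f (a * b)) : χ = 1 := by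
  obtain ⟨T, hT⟩ := exists_hom_of_factorSet ht hθ.ker_le_center χ (fun k x => mul_comm _ _) f hf
  -- `T` has abelian target, so it kills the derived subgroup.
  have h1 (k : θ.ker) : T k = 1 :=
    Abelianization.commutator_subset_ker T (hθ.ker_le_commutator k.2)
  -- The section is not normalised: `t 1` may differ from `1`, hence the correction factor.
  have h2 (k : θ.ker) : kerPart θ t ht k = k * kerPart θ t ht 1 := by
    apply Subtype.ext
    simp [kerPart, (MonoidHom.mem_ker).1 k.2]
  ext k : 1
  have h3 : T k = χ k * T 1 := by
    rw [hT, hT, h2, map_mul, (MonoidHom.mem_ker).1 k.2, map_one, mul_assoc]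
  rw [h1, map_one, mul_one] at h3
  exact h3.symm

/-- For a Schur cover, every two-cocycle of the quotient is cohomologous to the transgression of
a character of the kernel. -/
theorem exists_transgression_eq [Finite G] (hθ : IsStemExtension θ)
    (e : Additive θ.ker ≃+ SchurMultiplier H) (α : H → H → ℂˣ) (hα : IsTrivialCocycle α) :
    ∃ (χ : θ.ker →* ℂˣ) (f : H → ℂˣ),
      ∀ a b, α a b * f (a * b) = χ (factorSet θ t ht a b) * (f a * f b) := by
  let _ : CommGroup θ.ker := { (inferInstance : Group θ.ker) with
    mul_comm := fun a b => Subtype.ext (Subgroup.mem_center_iff.1 (hθ.ker_le_center b.2) a) }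
  obtain ⟨cl, hcl⟩ := exists_schurClass (H := H)
  let tg (χ : θ.ker →* ℂˣ) : SchurMultiplier H :=
    cl ⟨_, factorSet_cocycle ht hθ.ker_le_center χ⟩
  have hinj : Function.Injective tg := by
    intro χ χ' h
    obtain ⟨f, hf⟩ := (hcl _ _).1 h
    rw [← div_eq_one]
    refine eq_one_of_factorSet_coboundary ht hθ (χ / χ') f fun a b => ?_
    rw [MonoidHom.div_apply, div_mul_eq_mul_div, hf, mul_div_cancel_left]
  -- A finite abelian group has as many complex characters as elements.
  have hcard : Nat.card (θ.ker →* ℂˣ) = Nat.card (SchurMultiplier H) := by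
    rw [CommGroup.card_monoidHom_of_hasEnoughRootsOfUnity, ← Nat.card_congr e.toEquiv]
    rfl
  have : Finite (SchurMultiplier H) := Finite.of_equiv (Additive θ.ker) e.toEquiv
  obtain ⟨χ, hχ⟩ := ((Nat.bijective_iff_injective_and_card tg).2 ⟨hinj, hcard⟩).2 (cl ⟨α, hα⟩)
  obtain ⟨f, hf⟩ := (hcl _ _).1 hχ.symm
  exact ⟨χ, f, hf⟩

/-- Homomorphisms from a Schur cover to a quotient by central scalars lift if they are trivial on
the kernel. -/
theorem exists_lift_of_schurCover [Finite G] (hθ : IsStemExtension θ)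
    (e : Additive θ.ker ≃+ SchurMultiplier H) {Γ Δ : Type*} [Group Γ] [Group Δ] (c : ℂˣ →* Γ)
    (hc : Function.Injective c) (hcomm : ∀ k x, c k * x = x * c k) (π : Γ →* Δ)
    (hπ : Function.Surjective π) (hker : π.ker = c.range) (σ : G →* Δ) (hσ : θ.ker ≤ σ.ker) :
    ∃ T : G →* Γ, ∀ g, π (T g) = σ g := by
  choose t ht using hθ.surjective
  choose s hs using fun a => hπ (σ (t a))
  have hπc (z : ℂˣ) : π (c z) = 1 := by
    rw [← MonoidHom.mem_ker, hker]
    exact ⟨z, rfl⟩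
  -- `σ` kills the factor set, so `s` is multiplicative modulo scalars.
  have hdefect (a b : H) : ∃ z, c z = s a * s b * (s (a * b))⁻¹ := by
    rw [← MonoidHom.mem_range, ← hker, MonoidHom.mem_ker]
    simp only [map_mul, map_inv, hs]
    simpa [factorSet] using hσ (factorSet θ t ht a b).2
  choose α hα using hdefect
  have hα' (a b : H) : s a * s b = c (α a b) * s (a * b) := by rw [hα, inv_mul_cancel_right]
  obtain ⟨χ, f, hf⟩ :=
    exists_transgression_eq ht hθ e α (isTrivialCocycle_of_mul_eq c hc hcomm hα')
  -- Rescaling `s` by `f⁻¹` changes its defect from `α` to the transgression of `χ`.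
  obtain ⟨T, hT⟩ := exists_hom_of_factorSet ht hθ.ker_le_center (c.comp χ)
    (fun k x => hcomm _ _) (fun a => c (f a)⁻¹ * s a) fun a b => by
      have h : (f a)⁻¹ * (f b)⁻¹ * α a b = χ (factorSet θ t ht a b) * (f (a * b))⁻¹ := by
        rw [eq_mul_inv_iff_mul_eq, mul_assoc, hf, mul_left_comm, ← mul_inv, inv_mul_cancel,
          mul_one]
      calc c (f a)⁻¹ * s a * (c (f b)⁻¹ * s b)
          = c (f a)⁻¹ * c (f b)⁻¹ * (s a * s b) := by
            rw [mul_assoc, ← mul_assoc (s a), ← hcomm, mul_assoc, mul_assoc]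
        _ = c ((f a)⁻¹ * (f b)⁻¹ * α a b) * s (a * b) := by
            rw [hα', map_mul, map_mul, mul_assoc, mul_assoc, mul_assoc]
        _ = _ := by rw [h, map_mul, mul_assoc]; rfl
  refine ⟨T, fun g => ?_⟩
  have h := hσ (kerPart θ t ht g).2
  simp only [kerPart, MonoidHom.mem_ker, map_mul, map_inv, mul_inv_eq_one] at h
  rw [hT, map_mul, map_mul, MonoidHom.comp_apply, hπc, hπc, one_mul, one_mul, hs, h]

end Extension


/-! ### Schur's lemma in countable dimension -/

section Schur

open Polynomial

theorem linearIndependent_of_sub_apply_eq {V : Type w} [AddCommGroup V] [Module ℂ V]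
    {d : Module.End ℂ V} (hd : ∀ p : ℂ[X], p ≠ 0 → Function.Injective (aeval d p)) {v : V}
    (hv : v ≠ 0) {w : ℂ → V} (hw : ∀ c, (d - algebraMap ℂ (Module.End ℂ V) c) (w c) = v) :
    LinearIndependent ℂ w := by
  classical
  refine linearIndependent_iff'.2 fun s m hm i hi => ?_
  have hX (j : ℂ) : aeval d (X - C j) = d - algebraMap ℂ (Module.End ℂ V) j := by simp
  -- The numerator of `∑ m i / (X - i)` over the common denominator; its value at `i` is `m i` times
  -- a nonzero product.
  let p : ℂ[X] := ∑ i ∈ s, C (m i) * ∏ j ∈ s.erase i, (X - C j)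
  have hpv : aeval d p v = aeval d (∏ j ∈ s, (X - C j)) (∑ i ∈ s, m i • w i) := by
    simp only [p, map_sum, LinearMap.sum_apply, map_smul]
    refine Finset.sum_congr rfl fun i hi => ?_
    rw [← s.prod_erase_mul _ hi, map_mul, map_mul, Module.End.mul_apply, Module.End.mul_apply, hX,
      hw, aeval_C, Module.algebraMap_end_apply]
  have hp : p = 0 := by
    by_contra h
    rw [hm, map_zero] at hpv
    exact hv (hd p h (hpv.trans (map_zero _).symm))
  have he := congrArg (eval i) hp
  simp only [p, eval_finsetSum, eval_mul, eval_C, eval_prod, eval_sub, eval_X, eval_zero] at he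
  rw [Finset.sum_eq_single_of_mem i hi fun j hj hji => by
    rw [Finset.prod_eq_zero (Finset.mem_erase.2 ⟨hji.symm, hi⟩) (sub_self i), mul_zero]] at he
  exact (mul_eq_zero.1 he).resolve_right (Finset.prod_ne_zero_iff.2 fun j hj =>
    sub_ne_zero.2 (Finset.ne_of_mem_erase hj).symm)

/-- An endomorphism of a nonzero complex vector space of countable dimension has nonempty
spectrum. -/
theorem spectrum_nonempty_of_rank_le_aleph0 {V : Type w} [AddCommGroup V] [Module ℂ V]
    [Nontrivial V] (hV : Module.rank ℂ V ≤ Cardinal.aleph0) (d : Module.End ℂ V) :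
    (spectrum ℂ d).Nonempty := by
  by_contra! h
  have hunit (c : ℂ) : IsUnit (d - algebraMap ℂ (Module.End ℂ V) c) := by
    have hc : c ∉ spectrum ℂ d := by simp [h]
    rw [spectrum.notMem_iff] at hc
    simpa using hc.neg
  have hinj (p : ℂ[X]) (hp : p ≠ 0) : Function.Injective (aeval d p) := by
    rcases Nat.eq_zero_or_pos p.natDegree with h0 | h0
    · rw [eq_C_of_natDegree_eq_zero h0] at hp ⊢
      rw [aeval_C]
      exact smul_right_injective V (C_ne_zero.1 hp)
    · have := spectrum.map_polynomial_aeval_of_degree_pos d p (natDegree_pos_iff_degree_pos.1 h0)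
      rw [h, Set.image_empty] at this
      have h' : (0 : ℂ) ∉ spectrum ℂ (aeval d p) := by simp [this]
      rw [spectrum.zero_notMem_iff, Module.End.isUnit_iff] at h'
      exact h'.1
  obtain ⟨v, hv⟩ := exists_ne (0 : V)
  choose w hw using fun c => ((Module.End.isUnit_iff _).1 (hunit c)).2 v
  -- The vectors `(d - c)⁻¹ v`, for `c` in `ℂ`, form an independent family of continuum size.
  have hli := (linearIndependent_of_sub_apply_eq hinj hv hw).cardinal_lift_le_rank
  rw [Cardinal.mk_complex] at hli
  have := hli.trans (Cardinal.lift_le.2 hV)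
  simp only [Cardinal.lift_continuum, Cardinal.lift_aleph0] at this
  exact absurd this (not_le.2 Cardinal.aleph0_lt_continuum)

/-- A complex vector space with no proper nonzero subspace stable under a countable family of
endomorphisms has countable dimension. -/
theorem rank_le_aleph0_of_irreducible {ι : Type u} [Countable ι] {V : Type w} [AddCommGroup V]
    [Module ℂ V] [Nontrivial V] (ρ : ι → Module.End ℂ V)
    (hρ : ∀ W : Submodule ℂ V, (∀ i, ∀ w ∈ W, ρ i w ∈ W) → W = ⊥ ∨ W = ⊤) :
    Module.rank ℂ V ≤ Cardinal.aleph0 := by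
  obtain ⟨v, hv⟩ := exists_ne (0 : V)
  let orb (L : List ι) : V := (L.map ρ).prod v
  let W := Submodule.span ℂ (Set.range orb)
  have hW : W = ⊤ := by
    refine (hρ W fun i w hw => ?_).resolve_left fun h => hv ?_
    · have : W ≤ W.comap (ρ i) := by
        rw [Submodule.span_le]
        rintro _ ⟨L, rfl⟩
        exact Submodule.subset_span ⟨i :: L, by simp [orb]⟩
      exact this hw
    · rw [← Submodule.mem_bot ℂ, ← h]
      exact Submodule.subset_span ⟨[], by simp [orb]⟩
  rw [← rank_top ℂ V, ← hW]
  exact (rank_span_le _).trans (Set.countable_range orb).le_aleph0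

/-- Schur's lemma for a countable irreducible family of operators on a complex vector space. -/
theorem exists_eq_algebraMap_of_irreducible {ι : Type u} [Countable ι] {V : Type w}
    [AddCommGroup V] [Module ℂ V] [Nontrivial V] (ρ : ι → Module.End ℂ V)
    (hρ : ∀ W : Submodule ℂ V, (∀ i, ∀ w ∈ W, ρ i w ∈ W) → W = ⊥ ∨ W = ⊤)
    (d : Module.End ℂ V) (hd : ∀ i, ρ i * d = d * ρ i) :
    ∃ c : ℂ, d = algebraMap ℂ (Module.End ℂ V) c := by
  obtain ⟨c, hc⟩ := spectrum_nonempty_of_rank_le_aleph0 (rank_le_aleph0_of_irreducible ρ hρ) d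
  refine ⟨c, ?_⟩
  set f := algebraMap ℂ (Module.End ℂ V) c - d with hf
  suffices f = 0 from (sub_eq_zero.1 this).symm
  have hcomm (i : ι) (w : V) : ρ i (f w) = f (ρ i w) := by
    have : ρ i * f = f * ρ i := by
      rw [hf, mul_sub, sub_mul, hd, Algebra.commutes]
    exact LinearMap.congr_fun this w
  have h1 := hρ (LinearMap.ker f) fun i w hw => by
    rw [LinearMap.mem_ker] at hw ⊢
    rw [← hcomm, hw, map_zero]
  have h2 := hρ (LinearMap.range f) fun i w => by
    rintro ⟨x, rfl⟩
    exact ⟨ρ i x, (hcomm i x).symm⟩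
  rw [spectrum.mem_iff, Module.End.isUnit_iff, ← hf] at hc
  rcases h1 with h1 | h1
  · rcases h2 with h2 | h2
    · exact LinearMap.range_eq_bot.1 h2
    · exact absurd ⟨LinearMap.ker_eq_bot.1 h1, LinearMap.range_eq_top.1 h2⟩ hc
  · exact LinearMap.ker_eq_top.1 h1

end Schur


/-! ### Representations of conjugation quandles -/

section Main

theorem mul_inv_mul_comm_of_conj_eq {Γ : Type*} [Group Γ] {p q x : Γ}
    (h : p * x * p⁻¹ = q * x * q⁻¹) : x * (p⁻¹ * q) = p⁻¹ * q * x := by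
  rw [mul_inv_eq_iff_eq_mul] at h
  calc x * (p⁻¹ * q) = p⁻¹ * (p * x) * p⁻¹ * q := by group
    _ = p⁻¹ * q * x := by rw [h]; group

variable {V : Type w} [AddCommGroup V] [Module ℂ V]

theorem scalarGL_injective [Nontrivial V] : Function.Injective (scalarGL V) :=
  Units.map_injective (algebraMap ℂ (Module.End ℂ V)).injective

theorem toPGL_ker : (toPGL V).ker = (scalarGL V).range :=
  QuotientGroup.ker_mk' _

theorem toPGL_eq_iff {g h : LinearMap.GeneralLinearGroup ℂ V} :
    toPGL V g = toPGL V h ↔ ∃ z : ℂˣ, scalarGL V z * g = h := by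
  rw [eq_comm, ← mul_inv_eq_one, ← map_inv, ← map_mul, ← MonoidHom.mem_ker, toPGL_ker]
  simp only [MonoidHom.mem_range, eq_mul_inv_iff_mul_eq]

theorem scalarGL_mul_apply_mem_iff (z : ℂˣ) (g : LinearMap.GeneralLinearGroup ℂ V)
    (W : Submodule ℂ V) (w : V) :
    ((scalarGL V z * g : LinearMap.GeneralLinearGroup ℂ V) : Module.End ℂ V) w ∈ W ↔
      (g : Module.End ℂ V) w ∈ W :=
  W.smul_mem_iff z.ne_zero

namespace QuandleRep

section Conj

variable {G : Type u} [Group G] (ρ : QuandleRep (Quandle.Conj G) V)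

/-- The underlying function of a quandle representation of `Conj(G)`. -/
abbrev toGL (g : G) : LinearMap.GeneralLinearGroup ℂ V := ShelfHom.toFun ρ g

theorem toGL_conj (g h : G) : ρ.toGL (g * h * g⁻¹) = ρ.toGL g * ρ.toGL h * (ρ.toGL g)⁻¹ :=
  ShelfHom.map_act' ρ

theorem toGL_conj' (g h : G) : ρ.toGL (g * h * g⁻¹) * ρ.toGL g = ρ.toGL g * ρ.toGL h := by
  rw [toGL_conj, inv_mul_cancel_right]

variable {ρ} in
theorem IsIrreducible.exists_scalarGL_eq [Countable G] (hρ : ρ.IsIrreducible)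
    (u : LinearMap.GeneralLinearGroup ℂ V) (hu : ∀ g, ρ.toGL g * u = u * ρ.toGL g) :
    ∃ z : ℂˣ, scalarGL V z = u := by
  have := hρ.1
  obtain ⟨c, hc⟩ := exists_eq_algebraMap_of_irreducible
    (fun g => (ρ.toGL g : Module.End ℂ V)) hρ.2 u fun g => congrArg Units.val (hu g)
  have hc0 : c ≠ 0 := by
    rintro rfl
    exact u.ne_zero (hc.trans (map_zero _))
  exact ⟨Units.mk0 c hc0, Units.ext hc.symm⟩

variable {ρ} in
/-- An irreducible quandle representation of `Conj(G)` is projectively a representation of `G`,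
trivial on the centre. -/
theorem IsIrreducible.exists_projective [Countable G] (hρ : ρ.IsIrreducible) :
    ∃ σ : G →* PGL V, Subgroup.center G ≤ σ.ker ∧ ∀ g, σ g = toPGL V (ρ.toGL g) := by
  have hmul (g h : G) : toPGL V (ρ.toGL (g * h)) = toPGL V (ρ.toGL g) * toPGL V (ρ.toGL h) := by
    obtain ⟨z, hz⟩ := hρ.exists_scalarGL_eq ((ρ.toGL (g * h))⁻¹ * (ρ.toGL g * ρ.toGL h))
      fun x => by
        have h1 : ρ.toGL (g * h) * ρ.toGL x * (ρ.toGL (g * h))⁻¹ =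
            ρ.toGL g * ρ.toGL h * ρ.toGL x * (ρ.toGL g * ρ.toGL h)⁻¹ := by
          rw [← toGL_conj, show g * h * x * (g * h)⁻¹ = g * (h * x * h⁻¹) * g⁻¹ by group,
            toGL_conj, toGL_conj]
          simp only [mul_assoc, mul_inv_rev]
        exact mul_inv_mul_comm_of_conj_eq h1
    rw [← map_mul, toPGL_eq_iff]
    exact ⟨z, by rw [scalarGL_mul_comm, hz, mul_inv_cancel_left]⟩
  refine ⟨MonoidHom.mk' (fun g => toPGL V (ρ.toGL g)) hmul, fun z hz => ?_, fun g => rfl⟩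
  obtain ⟨c, hc⟩ := hρ.exists_scalarGL_eq (ρ.toGL z) fun x => by
    rw [← toGL_conj', Subgroup.mem_center_iff.1 hz x, mul_inv_cancel_right]
  change ρ.toGL z ∈ (toPGL V).ker
  rw [toPGL_ker]
  exact ⟨c, hc⟩

theorem isIrreducible_twist_iff (χ : QuandleCharacter (Quandle.Conj G)) :
    (twist χ ρ).IsIrreducible ↔ ρ.IsIrreducible := by
  have (W : Submodule ℂ V) (x : G) (w : V) :
      (((twist χ ρ).toGL x : LinearMap.GeneralLinearGroup ℂ V) : Module.End ℂ V) w ∈ W ↔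
        (ρ.toGL x : Module.End ℂ V) w ∈ W := scalarGL_mul_apply_mem_iff (χ x) _ W w
  exact and_congr_right fun _ => forall_congr' fun W => imp_congr_left <|
    forall_congr' fun x => forall_congr' fun w => imp_congr_right fun _ => this W x w

theorem isIrreducible_ofRepresentation_iff (ρ : Representation ℂ G V) :
    (ofRepresentation ρ).IsIrreducible ↔ ρ.IsIrreducible := by
  constructor
  · rintro ⟨hV, h⟩
    refine { exists_pair_ne := ⟨⊥, ⊤, fun he => ?_⟩, eq_bot_or_eq_top := fun W => ?_ }
    · exact bot_ne_top (α := Submodule ℂ V) (congrArg Subrepresentation.toSubmodule he)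
    · exact (h W.toSubmodule fun g w hw => W.apply_mem_toSubmodule g hw).imp
        (fun h => Subrepresentation.toSubmodule_injective h)
        (fun h => Subrepresentation.toSubmodule_injective h)
  · intro h
    refine ⟨?_, fun W hW => ?_⟩
    · by_contra hV
      rw [not_nontrivial_iff_subsingleton] at hV
      exact bot_ne_top (α := Subrepresentation ρ)
        (Subrepresentation.toSubmodule_injective (Subsingleton.elim _ _))
    · exact (h.eq_bot_or_eq_top ⟨W, fun g w hw => hW g w hw⟩).imp
        (congrArg Subrepresentation.toSubmodule) (congrArg Subrepresentation.toSubmodule)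

/-- A group homomorphism to `GL(V)` as a representation. -/
def representationOfHom (T : G →* LinearMap.GeneralLinearGroup ℂ V) : Representation ℂ G V :=
  (Units.coeHom (Module.End ℂ V)).comp T

theorem toGL_ofRepresentation_representationOfHom (T : G →* LinearMap.GeneralLinearGroup ℂ V)
    (g : G) : (ofRepresentation (representationOfHom T)).toGL g = T g :=
  Units.ext rfl

/-- The quandle `Conj(ℂˣ)` is trivial, so a character is a class function. The ratio of two quandle
representations is one, because scalars are central and cancel in conjugation. -/
theorem exists_eq_twist [Nontrivial V] (ρ' : QuandleRep (Quandle.Conj G) V)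
    (h : ∀ g, toPGL V (ρ'.toGL g) = toPGL V (ρ.toGL g)) :
    ∃ χ : QuandleCharacter (Quandle.Conj G), ρ = twist χ ρ' := by
  choose χ hχ using fun g => toPGL_eq_iff.1 (h g)
  refine ⟨⟨χ, fun {x y} => ?_⟩, DFunLike.ext _ _ fun g => (hχ g).symm⟩
  change χ (x * y * x⁻¹) = χ x * χ y * (χ x)⁻¹
  rw [mul_inv_cancel_comm]
  apply scalarGL_injective (V := V)
  apply mul_right_cancel (b := ρ'.toGL (x * y * x⁻¹))
  rw [hχ, toGL_conj, toGL_conj, ← hχ x, ← hχ y, mul_inv_eq_iff_eq_mul]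
  calc scalarGL V (χ x) * ρ'.toGL x * (scalarGL V (χ y) * ρ'.toGL y)
      = scalarGL V (χ x) * (scalarGL V (χ y) * ρ'.toGL x * ρ'.toGL y) := by
        rw [scalarGL_mul_comm V (χ y) (ρ'.toGL x)]
        simp only [mul_assoc]
    _ = scalarGL V (χ y) * (ρ'.toGL x * ρ'.toGL y * (ρ'.toGL x)⁻¹) *
          (scalarGL V (χ x) * ρ'.toGL x) := by
        rw [← mul_assoc _ (scalarGL V (χ x)), ← scalarGL_mul_comm V (χ x)]
        simp only [mul_assoc, inv_mul_cancel, mul_one]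

/-- The surjection from a group to the inner automorphism group of its conjugation quandle. -/
def toInnConj (G : Type u) [Group G] : G →* Inn (Quandle.Conj G) :=
  MonoidHom.mk' (fun g => leftTranslation (Quandle.Conj G) g) fun g h =>
    Subtype.ext (Equiv.ext fun x => by
      change g * h * x * (g * h)⁻¹ = g * (h * x * h⁻¹) * g⁻¹
      group)

theorem toInnConj_surjective : Function.Surjective (toInnConj G) := by
  rintro ⟨a, ha⟩
  have h : Inn (Quandle.Conj G) ≤ ((Inn (Quandle.Conj G)).subtype.comp (toInnConj G)).range := by
    rw [Subgroup.closure_le]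
    rintro _ ⟨x, rfl⟩
    exact ⟨x, rfl⟩
  obtain ⟨g, hg⟩ := h ha
  exact ⟨g, Subtype.ext hg⟩

theorem center_le_ker_toInnConj : Subgroup.center G ≤ (toInnConj G).ker := by
  intro z hz
  refine Subtype.ext (Equiv.ext fun x => ?_)
  change z * x * z⁻¹ = x
  rw [← Subgroup.mem_center_iff.1 hz x, mul_inv_cancel_right]

theorem induces_iff (σ : Inn (Quandle.Conj G) →* PGL V) :
    ρ.Induces σ ↔ ∀ g : G, σ (toInnConj G g) = toPGL V (ρ.toGL g) := by
  refine ⟨fun h g => h (Rack.toEnvelGroup _ g), fun h g => ?_⟩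
  -- Morphisms out of the enveloping group are determined by their values on the quandle.
  have : σ.comp (envelToInn (Quandle.Conj G)) = (toPGL V).comp (Rack.toEnvelGroup.map ρ) :=
    Rack.toEnvelGroup.map.symm.injective (DFunLike.ext _ _ h)
  exact DFunLike.congr_fun this g

end Conj

end QuandleRep

theorem IsSchurCover.exists_lift_toPGL {G : Type u} [Group G] [Finite G] {H : Type v} [Group H]
    (hGH : IsSchurCover G H) [Nontrivial V] (σ : G →* PGL V) (hσ : Subgroup.center G ≤ σ.ker) :
    ∃ T : G →* LinearMap.GeneralLinearGroup ℂ V, ∀ g, toPGL V (T g) = σ g := by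
  obtain ⟨θ, hθ, ⟨e⟩⟩ := hGH
  exact exists_lift_of_schurCover hθ e (scalarGL V) scalarGL_injective (scalarGL_mul_comm V)
    (toPGL V) (QuotientGroup.mk'_surjective _) toPGL_ker σ (hθ.ker_le_center.trans hσ)

end Main

open QuandleRep in
theorem mainTheorem3 {G : Type u} [Group G] [Finite G] {H : Type v} [Group H]
    (hGH : IsSchurCover G H) :
    (∀ (V : Type w) [AddCommGroup V] [Module ℂ V] (ρ : QuandleRep (Quandle.Conj G) V),
      ρ.IsIrreducible ↔
        ∃ (χ : QuandleCharacter (Quandle.Conj G)) (ρ' : Representation ℂ G V),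
          ρ'.IsIrreducible ∧ ρ = QuandleRep.twist χ (QuandleRep.ofRepresentation ρ')) ∧
    (∀ (V : Type w) [AddCommGroup V] [Module ℂ V] (σ : Inn (Quandle.Conj G) →* PGL V),
      IsIrreducibleProjective σ →
        ∃ ρ : QuandleRep (Quandle.Conj G) V, ρ.IsIrreducible ∧ ρ.Induces σ) := by
  refine ⟨fun V _ _ ρ => ⟨fun hρ => ?_, ?_⟩, fun V _ _ σ hσ => ?_⟩
  · have := hρ.1
    obtain ⟨σ, hσ, hσρ⟩ := hρ.exists_projective
    obtain ⟨T, hT⟩ := hGH.exists_lift_toPGL σ hσ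
    obtain ⟨χ, rfl⟩ := ρ.exists_eq_twist (ofRepresentation (representationOfHom T)) fun g => by
      rw [toGL_ofRepresentation_representationOfHom, hT, hσρ]
    rw [isIrreducible_twist_iff, isIrreducible_ofRepresentation_iff] at hρ
    exact ⟨χ, _, hρ, rfl⟩
  · rintro ⟨χ, ρ', h, rfl⟩
    rwa [isIrreducible_twist_iff, isIrreducible_ofRepresentation_iff]
  · have := hσ.1
    obtain ⟨T, hT⟩ := hGH.exists_lift_toPGL (σ.comp (toInnConj G))
      (center_le_ker_toInnConj.trans fun g hg => by
        rw [MonoidHom.mem_ker] at hg ⊢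
        rw [MonoidHom.comp_apply, hg, map_one])
    -- Lifts of `σ a` differ by scalars, so stability under `T` is stability under all of them.
    refine ⟨Quandle.Conj.map T, ⟨hσ.1, fun W hW => hσ.2 W fun a g hg w hw => ?_⟩,
      (induces_iff _ σ).2 fun g => (hT g).symm⟩
    obtain ⟨x, rfl⟩ := toInnConj_surjective a
    obtain ⟨z, rfl⟩ := toPGL_eq_iff.1 ((hT x).trans hg.symm)
    exact (scalarGL_mul_apply_mem_iff z (T x) W w).2 (hW x w hw)
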